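/- Let $\gamma,u>0$, let $f:\mathbb R^{n}\to\mathbb R$ be differentiable, and let $(B_t)_{t\ge 0}$ be a standard Brownian motion in $\mathbb R^{n}$. Let $(y_t,v_t)_{t\ge0}$ be a solution with continuous paths of the underdamped Langevin diffusion with friction $\gamma$, inverse mass $u$ and gradient frozen at the initial position, $$dv_t=-\gamma v_t\,dt-u\nabla f(y_0)\,dt+\sqrt{2\gamma u}\,dB_t,\qquad dy_t=v_t\,dt ,$$ whose (possibly random) initial condition $(y_0,v_0)$ is independent of $(B_t)_{t\ge0}$. Then for every $t\ge 0$, conditionally on $(y_0,v_0)$ (that is, for almost every value of $(y_0,v_0)$ under its law), the pair $(y_t,v_t)$ is Gaussian on $\mathbb R^{n}\times\mathbb R^{n}$ (possibly degenerate, as at $t=0$) with conditional means $$\mathbb E[v_t]=e^{-\gamma t}v_0-\gamma^{-1}u(1-e^{-\gamma t})\nabla f(y_0),$$ $$\mathbb E[y_t]=y_0+\gamma^{-1}(1-e^{-\gamma t})v_0-\gamma^{-1}u\bigl(t-\gamma^{-1}(1-e^{-\gamma t})\bigr)\nabla f(y_0),$$ and conditional covariances $$\mathbb E[(y_t-\mathbb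 E[y_t])(y_t-\mathbb E[y_t])^\top]=\gamma^{-1}u\bigl(2t-4\gamma^{-1}(1-e^{-\gamma t})+\gamma^{-1}(1-e^{-2\gamma t})\bigr)I_{n},$$ $$\mathbb E[(v_t-\mathbb E[v_t])(v_t-\mathbb E[v_t])^\top]=u(1-e^{-2\gamma t})\,I_{n},$$ $$\mathbb E[(y_t-\mathbb E[y_t])(v_t-\mathbb E[v_t])^\top]=\gamma^{-1}u(1-2e^{-\gamma t}+e^{-2\gamma t})\,I_{n}.$$ -/

import Mathlib

open MeasureTheory ProbabilityTheory
open scoped NNReal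

/-- Standard Brownian motion in `ℝⁿ`: the coordinates are independent processes, and each of
them is a standard real Brownian motion. -/
structure IsBrownianVec {Ω : Type*} [MeasurableSpace Ω] {n : ℕ}
    (B : ℝ≥0 → Ω → EuclideanSpace ℝ (Fin n)) (P : Measure Ω) : Prop where
  isBrownianReal : ∀ i : Fin n, IsBrownianReal (fun t ω => B t ω i) P
  iIndepFun_coord : iIndepFun (fun (i : Fin n) (ω : Ω) (t : ℝ≥0) => B t ω i) P

/-- `(Y, V)` is a (strong) solution of the underdamped Langevin diffusion with friction `γ`,
inverse mass `u` and gradient of `f` frozen at the starting position,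
`dV = -γ V dt - u ∇f(Y₀) dt + √(2γu) dB`, `dY = V dt`.
The noise is additive, so the stochastic integral `∫₀ᵗ √(2γu) dB` is `√(2γu) (B t - B 0)` and the
integral form of the equation involves only integrals of continuous paths. -/
structure IsFrozenLangevin {Ω : Type*} [MeasurableSpace Ω] {n : ℕ} (γ u : ℝ)
    (f : EuclideanSpace ℝ (Fin n) → ℝ) (B Y V : ℝ≥0 → Ω → EuclideanSpace ℝ (Fin n))
    (P : Measure Ω) : Prop where
  aemeasurable_position : ∀ t, AEMeasurable (Y t) P
  aemeasurable_velocity : ∀ t, AEMeasurable (V t) P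
  continuous_position : ∀ᵐ ω ∂P, Continuous fun t => Y t ω
  continuous_velocity : ∀ᵐ ω ∂P, Continuous fun t => V t ω
  velocity_eq : ∀ᵐ ω ∂P, ∀ t : ℝ≥0,
    V t ω = V 0 ω + (∫ s in (0 : ℝ)..t, (-(γ • V s.toNNReal ω) - u • gradient f (Y 0 ω)))
      + √(2 * γ * u) • (B t ω - B 0 ω)
  position_eq : ∀ᵐ ω ∂P, ∀ t : ℝ≥0,
    Y t ω = Y 0 ω + ∫ s in (0 : ℝ)..t, V s.toNNReal ω

/-- The matrix `E[(X - E X) (Z - E Z)ᵀ]` of two random vectors under `ν`. -/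
noncomputable def crossCov {S : Type*} [MeasurableSpace S] {n : ℕ}
    (X Z : S → EuclideanSpace ℝ (Fin n)) (ν : Measure S) : Matrix (Fin n) (Fin n) ℝ :=
  Matrix.of fun i j => cov[fun x => X x i, fun x => Z x j; ν]

/-!
The equation is linear and its noise is additive, so it is solved path by path. The displacement
`I(t) = ∫₀ᵗ V` satisfies `I' = V₀ - γ I - u t ∇f(Y₀) + c B` with `c = √(2γu)`, and the integrating
factor `exp(γ t)` gives
`I(t) = (noiseless part) + c ∫₀ᵗ exp(-γ(t-s)) B(s) ds` (`integral_velocity_eq`). After an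
integration by parts the noise in `Y t` and in `V t` becomes a pair of Wiener integrals
`∫₀ᵗ h dB` of the deterministic functions `c γ⁻¹ (1 - exp(-γ(t-s)))` and `c exp(-γ(t-s))`
(`IsFrozenLangevin.ae_eq_noiselessFlow_add`).

For continuously differentiable `h` no stochastic calculus is needed: `∫₀ᵗ h dB` is the limit of
Riemann–Stieltjes sums along every continuous path, because summation by parts moves the increments
onto `h` (`tendsto_stieltjesSum`). These sums are Gaussian with variance a Riemann sum of `h²`,
since the increments of `B` are independent, so the limit has law `N(0, ∫₀ᵗ h²)`
(`IsBrownianReal.hasLaw_wienerIntegral`). By linearity in `h`, two Wiener integrals are jointly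
Gaussian with covariance `∫₀ᵗ h k`, and by independence of the coordinates so are their vector
versions, with covariance matrices proportional to the identity.

The Wiener integral is defined as an upper limit, hence it is a measurable function of the path for
the product σ-algebra. Independence of the coordinates of `B`, and of `B` from the initial
condition, therefore passes to Wiener integrals, although integration in time itself is not
measurable on the space of all paths. Given the initial condition `x`, the law of `(Y t, V t)` is
then the Gaussian law of the noise translated by the noiseless flow from `x`
(`condDistrib_ae_eq_map_add`), and the stated moments are elementary integrals.
-/

open Filter Topology

/-! ### Riemann–Stieltjes sums and the pathwise Wiener integral -/

/-- The `m`-th Riemann–Stieltjes sum of `h` against the path `p` on `[0, t]`, for the subdivision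
into `m` intervals of equal length with left endpoints as tags. -/
noncomputable def stieltjesSum (h : ℝ → ℝ) (t : ℝ≥0) (m : ℕ) (p : ℝ≥0 → ℝ) : ℝ :=
  ∑ k ∈ Finset.range m, h (t * k / m : ℝ≥0) * (p (t * (k + 1 : ℕ) / m) - p (t * k / m))

/-- The Wiener integral `∫₀ᵗ h dp`, defined pathwise as the upper limit of the Riemann–Stieltjes
sums. The upper limit makes it a measurable function of an arbitrary path `p`; for a continuous
path and a continuously differentiable `h` it is a limit. -/
noncomputable def wienerIntegral (h : ℝ → ℝ) (t : ℝ≥0) (p : ℝ≥0 → ℝ) : ℝ :=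
  limsup (fun m => stieltjesSum h t m p) atTop

lemma measurable_stieltjesSum (h : ℝ → ℝ) (t : ℝ≥0) (m : ℕ) : Measurable (stieltjesSum h t m) := by
  unfold stieltjesSum
  fun_prop

lemma measurable_wienerIntegral (h : ℝ → ℝ) (t : ℝ≥0) : Measurable (wienerIntegral h t) :=
  Measurable.limsup fun m => measurable_stieltjesSum h t m

/-- Riemann sums of `q` with respect to the measure `g ds`, tagged at right endpoints. -/
lemma tendsto_sum_mul_integral {q g : ℝ → ℝ} (hq : Continuous q) (hg : Continuous g) {t : ℝ}
    (ht : 0 ≤ t) :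
    Tendsto (fun m : ℕ => ∑ k ∈ Finset.range m,
        q (t * (k + 1 : ℕ) / m) * ∫ s in (t * k / m)..(t * (k + 1 : ℕ) / m), g s)
      atTop (𝓝 (∫ s in (0 : ℝ)..t, q s * g s)) := by
  obtain ⟨M, hM⟩ := (isCompact_Icc (a := (0 : ℝ)) (b := t)).exists_bound_of_continuousOn
    hg.continuousOn
  have hqg : Continuous fun s => q s * g s := hq.mul hg
  have hM0 : 0 ≤ M := (norm_nonneg _).trans (hM 0 ⟨le_rfl, ht⟩)
  have huc := (isCompact_Icc (a := (0 : ℝ)) (b := t)).uniformContinuousOn_of_continuous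
    hq.continuousOn
  rw [Metric.tendsto_atTop]
  intro ε hε
  -- the total error is at most `M t` times the oscillation of `q`; adding `1` allows `M t = 0`
  obtain ⟨δ, hδ, hδq⟩ := Metric.uniformContinuousOn_iff.1 huc (ε / (2 * (M * t + 1)))
    (by positivity)
  obtain ⟨N, hN⟩ := exists_nat_gt (t / δ)
  refine ⟨N + 1, fun m hm => ?_⟩
  have hm0 : (0 : ℝ) < m := by exact_mod_cast (Nat.succ_pos N).trans_le hm
  have hmesh : t / m < δ := by
    have : (N : ℝ) < m := by exact_mod_cast hm
    rw [div_lt_iff₀ hδ] at hN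
    rw [div_lt_iff₀ hm0]
    nlinarith
  have hsplit : ∫ s in (0 : ℝ)..t, q s * g s
      = ∑ k ∈ Finset.range m, ∫ s in (t * k / m)..(t * (k + 1 : ℕ) / m), q s * g s := by
    rw [intervalIntegral.sum_integral_adjacent_intervals (a := fun k : ℕ => t * k / m)
      (fun k _ => hqg.intervalIntegrable _ _)]
    simp [hm0.ne']
  rw [hsplit, Real.dist_eq, ← Finset.sum_sub_distrib]
  have hterm : ∀ k ∈ Finset.range m,
      |q (t * (k + 1 : ℕ) / m) * (∫ s in (t * k / m)..(t * (k + 1 : ℕ) / m), g s)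
        - ∫ s in (t * k / m)..(t * (k + 1 : ℕ) / m), q s * g s|
      ≤ ε / (2 * (M * t + 1)) * M * (t / m) := by
    intro k hk
    have hkm : ((k : ℝ) + 1) ≤ m := by exact_mod_cast Finset.mem_range.1 hk
    have hle : t * k / m ≤ t * (k + 1 : ℕ) / m := by
      push_cast
      gcongr
      linarith
    have hlen : t * (k + 1 : ℕ) / m - t * k / m = t / m := by
      push_cast
      ring
    have hlow : 0 ≤ t * k / m := by positivity
    have hupp : t * (k + 1 : ℕ) / m ≤ t := by
      push_cast
      rw [div_le_iff₀ hm0]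
      gcongr
    rw [← intervalIntegral.integral_const_mul, ← intervalIntegral.integral_sub
      ((hg.const_mul _).intervalIntegrable _ _) (hqg.intervalIntegrable _ _), ← Real.norm_eq_abs]
    refine (intervalIntegral.norm_integral_le_of_norm_le_const
      (C := ε / (2 * (M * t + 1)) * M) fun s hs => ?_).trans_eq ?_
    · rw [Set.uIoc_of_le hle] at hs
      have hsI : s ∈ Set.Icc 0 t := ⟨hlow.trans hs.1.le, hs.2.trans hupp⟩
      have hd := hδq (t * (k + 1 : ℕ) / m) ⟨hlow.trans hle, hupp⟩ s hsI (by
        rw [Real.dist_eq, abs_of_nonneg (by linarith [hs.2])]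
        linarith [hs.1])
      rw [← sub_mul, norm_mul]
      gcongr
      · exact hd.le
      · exact hM s hsI
    · rw [hlen, abs_of_nonneg (by positivity)]
  refine (Finset.abs_sum_le_sum_abs _ _).trans_lt ((Finset.sum_le_sum hterm).trans_lt ?_)
  rw [Finset.sum_const, Finset.card_range, nsmul_eq_mul]
  have : (m : ℝ) * (ε / (2 * (M * t + 1)) * M * (t / m)) = ε * (M * t / (2 * (M * t + 1))) := by
    field_simp
  rw [this]
  have h1 : M * t / (2 * (M * t + 1)) < 1 := by
    rw [div_lt_one (by positivity)]
    nlinarith [mul_nonneg hM0 ht]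
  nlinarith

/-- Summation by parts turns Riemann–Stieltjes sums of a continuously differentiable function into
Riemann sums, so that they converge along every continuous path. -/
lemma tendsto_stieltjesSum {h h' : ℝ → ℝ} (hh : ∀ s, HasDerivAt h (h' s) s) (hh' : Continuous h')
    {p : ℝ≥0 → ℝ} (hp : Continuous p) (t : ℝ≥0) :
    Tendsto (fun m => stieltjesSum h t m p) atTop
      (𝓝 (h t * p t - h 0 * p 0 - ∫ s in (0 : ℝ)..t, p s.toNNReal * h' s)) := by
  have hq : Continuous fun s : ℝ => p s.toNNReal := hp.comp continuous_real_toNNReal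
  refine Tendsto.congr' ?_ ((tendsto_sum_mul_integral hq hh' t.coe_nonneg).const_sub
    (h t * p t - h 0 * p 0))
  filter_upwards [eventually_gt_atTop 0] with m hm
  have hm0 : (m : ℝ≥0) ≠ 0 := by exact_mod_cast hm.ne'
  have htel := Finset.sum_range_sub
    (fun k : ℕ => h (t * k / m : ℝ≥0) * p (t * k / m)) m
  simp only [mul_div_assoc, div_self hm0, mul_one, Nat.cast_zero, zero_div, mul_zero,
    NNReal.coe_zero] at htel
  unfold stieltjesSum
  simp only [mul_div_assoc]
  change _ - _ = _
  rw [← htel, ← Finset.sum_sub_distrib]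
  refine Finset.sum_congr rfl fun k _ => ?_
  rw [intervalIntegral.integral_eq_sub_of_hasDerivAt (fun s _ => hh s)
    (hh'.intervalIntegrable _ _)]
  have e (k : ℕ) : (t : ℝ) * (k / m) = ((t * (k / m) : ℝ≥0) : ℝ) := by push_cast; rfl
  rw [e, e, Real.toNNReal_coe]
  ring

lemma wienerIntegral_eq {h h' : ℝ → ℝ} (hh : ∀ s, HasDerivAt h (h' s) s) (hh' : Continuous h')
    {p : ℝ≥0 → ℝ} (hp : Continuous p) (t : ℝ≥0) :
    wienerIntegral h t p = h t * p t - h 0 * p 0 - ∫ s in (0 : ℝ)..t, p s.toNNReal * h' s :=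
  (tendsto_stieltjesSum hh hh' hp t).limsup_eq

/-- The variances of the Riemann–Stieltjes sums of Brownian motion converge to `∫₀ᵗ h²`. -/
lemma tendsto_sum_sq_mul {h h' : ℝ → ℝ} (hh : ∀ s, HasDerivAt h (h' s) s) (hh' : Continuous h')
    (t : ℝ≥0) :
    Tendsto (fun m : ℕ => ∑ k ∈ Finset.range m, h (t * k / m : ℝ≥0) ^ 2 * (t / m : ℝ)) atTop
      (𝓝 (∫ s in (0 : ℝ)..t, h s ^ 2)) := by
  have hcont : Continuous h := continuous_iff_continuousAt.2 fun s => (hh s).continuousAt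
  have hd : ∀ s, HasDerivAt (fun s => h s ^ 2) (2 * h s * h' s) s := fun s => by
    simpa using (hh s).fun_pow 2
  have hd' : Continuous fun s => 2 * h s * h' s := by fun_prop
  -- the squares are summed against the path `s ↦ s`
  have key := tendsto_stieltjesSum hd hd' NNReal.continuous_coe t
  have hval : h t ^ 2 * t - h 0 ^ 2 * ((0 : ℝ≥0) : ℝ)
      - ∫ s in (0 : ℝ)..t, (s.toNNReal : ℝ) * (2 * h s * h' s) = ∫ s in (0 : ℝ)..t, h s ^ 2 := by
    have hparts := intervalIntegral.integral_mul_deriv_eq_deriv_mul (a := 0) (b := (t : ℝ))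
      (fun s _ => hasDerivAt_id s) (fun s _ => hd s)
      (intervalIntegrable_const (c := (1 : ℝ))) (hd'.intervalIntegrable _ _)
    have hcongr : ∫ s in (0 : ℝ)..t, (s.toNNReal : ℝ) * (2 * h s * h' s)
        = ∫ s in (0 : ℝ)..t, id s * (2 * h s * h' s) := by
      refine intervalIntegral.integral_congr fun s hs => ?_
      rw [Set.uIcc_of_le t.coe_nonneg] at hs
      simp [Real.coe_toNNReal s hs.1]
    rw [hcongr, hparts]
    simp
    ring
  rw [hval] at key
  refine key.congr fun m => Finset.sum_congr rfl fun k _ => ?_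
  push_cast
  ring

/-! ### The law of the Wiener integral -/

section

variable {Ω : Type*} [MeasurableSpace Ω] {P : Measure Ω}

/-- An almost sure limit of centred Gaussian variables whose variances converge is Gaussian, as
the characteristic functions converge by dominated convergence. -/
lemma hasLaw_gaussianReal_of_tendsto_ae [IsProbabilityMeasure P] {X : ℕ → Ω → ℝ} {Z : Ω → ℝ}
    {σ : ℕ → ℝ≥0} {σ' : ℝ≥0} (hX : ∀ m, HasLaw (X m) (gaussianReal 0 (σ m)) P)
    (hσ : Tendsto σ atTop (𝓝 σ')) (hlim : ∀ᵐ ω ∂P, Tendsto (fun m => X m ω) atTop (𝓝 (Z ω))) :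
    HasLaw Z (gaussianReal 0 σ') P := by
  have hZ : AEMeasurable Z P :=
    aemeasurable_of_tendsto_metrizable_ae _ (fun m => (hX m).aemeasurable) hlim
  refine ⟨hZ, ?_⟩
  have := Measure.isProbabilityMeasure_map hZ
  refine Measure.ext_of_charFun (funext fun θ => ?_)
  have hcont : Continuous fun x : ℝ => Complex.exp (θ * x * Complex.I) := by fun_prop
  have h1 : Tendsto (fun m => charFun (P.map (X m)) θ) atTop (𝓝 (charFun (P.map Z) θ)) := by
    have e {W : Ω → ℝ} (hW : AEMeasurable W P) :
        charFun (P.map W) θ = ∫ ω, Complex.exp (θ * W ω * Complex.I) ∂P := by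
      rw [charFun_apply_real, integral_map hW hcont.aestronglyMeasurable]
    simp_rw [fun m => e (hX m).aemeasurable]
    rw [e hZ]
    refine tendsto_integral_of_dominated_convergence (fun _ => 1)
      (fun m => hcont.comp_aestronglyMeasurable (hX m).aemeasurable.aestronglyMeasurable)
      (integrable_const _) (fun m => ae_of_all _ fun ω => ?_) ?_
    · rw [← Complex.ofReal_mul, Complex.norm_exp_ofReal_mul_I]
    · filter_upwards [hlim] with ω hω
      exact (hcont.tendsto _).comp hω
  have h2 : Tendsto (fun m => charFun (P.map (X m)) θ) atTop
      (𝓝 (charFun (gaussianReal 0 σ') θ)) := by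
    simp_rw [fun m => (hX m).map_eq, charFun_gaussianReal]
    have hc : Continuous fun v : ℝ≥0 =>
        Complex.exp (θ * ((0 : ℝ) : ℂ) * Complex.I - ((v : ℝ) : ℂ) * θ ^ 2 / 2) := by fun_prop
    exact (hc.tendsto σ').comp hσ
  exact tendsto_nhds_unique h1 h2

/-- Riemann–Stieltjes sums of a pre-Brownian motion are Gaussian, because its increments are
independent and Gaussian. -/
lemma ProbabilityTheory.IsPreBrownianReal.hasLaw_stieltjesSum {B : ℝ≥0 → Ω → ℝ}
    (hB : IsPreBrownianReal B P) (h : ℝ → ℝ) (t : ℝ≥0) (m : ℕ) :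
    HasLaw (fun ω => stieltjesSum h t m fun s => B s ω)
      (gaussianReal 0
        (∑ k ∈ Finset.range m, h (t * k / m : ℝ≥0) ^ 2 * (t / m : ℝ)).toNNReal) P := by
  have : IsProbabilityMeasure P := hB.isGaussianProcess.isProbabilityMeasure
  set D : Fin m → Ω → ℝ := fun i ω =>
    h (t * (i : ℕ) / m : ℝ≥0) * (B (t * ((i : ℕ) + 1 : ℕ) / m) ω - B (t * (i : ℕ) / m) ω) with hD
  have hsum : (fun ω => stieltjesSum h t m fun s => B s ω) = fun ω => ∑ i, D i ω := by
    ext ω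
    rw [stieltjesSum, Finset.sum_range]
  have hindep : iIndepFun D P := by
    have hmono : Monotone fun i : Fin (m + 1) => t * (i : ℕ) / (m : ℝ≥0) := fun i j hij => by
      have : (i : ℕ) ≤ (j : ℕ) := hij
      dsimp only
      gcongr
    exact (hB.hasIndepIncrements m _ hmono).comp
      (fun i x => h (t * (i : ℕ) / m : ℝ≥0) * x) (fun i => by fun_prop)
  have hinc (i : Fin m) : HasLaw (fun ω => B (t * ((i : ℕ) + 1 : ℕ) / m) ω - B (t * (i : ℕ) / m) ω)
      (gaussianReal 0 (t / m)) P := by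
    have hlen : nndist ((t * ((i : ℕ) + 1 : ℕ) / m : ℝ≥0) : ℝ) ((t * (i : ℕ) / m : ℝ≥0) : ℝ)
        = t / m := by
      have : ((t * ((i : ℕ) + 1 : ℕ) / m : ℝ≥0) : ℝ) - ((t * (i : ℕ) / m : ℝ≥0) : ℝ)
          = ((t / m : ℝ≥0) : ℝ) := by
        push_cast
        ring
      rw [← NNReal.coe_inj, coe_nndist, Real.dist_eq, this, abs_of_nonneg (NNReal.coe_nonneg _)]
    rw [← hlen]
    exact hB.hasLaw_sub (t * ((i : ℕ) + 1 : ℕ) / m) (t * (i : ℕ) / m)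
  have hDG (i : Fin m) : HasGaussianLaw (D i) P := by
    simpa [hD] using (hinc i).hasGaussianLaw.fun_smul (h (t * (i : ℕ) / m : ℝ≥0))
  have hG : HasGaussianLaw (fun ω => ∑ i, D i ω) P := hindep.hasGaussianLaw_fun_sum hDG
  rw [hsum]
  refine ⟨hG.aemeasurable, ?_⟩
  rw [hG.map_eq_gaussianReal]
  congr 1
  · rw [integral_finsetSum _ fun i _ => (hDG i).integrable]
    refine Finset.sum_eq_zero fun i _ => ?_
    simp only [hD]
    rw [integral_const_mul, (hinc i).integral_eq, integral_id_gaussianReal, mul_zero]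
  · congr 1
    have hv := IndepFun.variance_sum (s := Finset.univ) (fun i _ => (hDG i).memLp_two)
      (fun i _ j _ hij => hindep.indepFun hij)
    rw [Finset.sum_fn] at hv
    rw [hv, Finset.sum_range]
    refine Finset.sum_congr rfl fun i _ => ?_
    simp only [hD]
    rw [variance_const_mul, (hinc i).variance_eq, variance_id_gaussianReal]
    push_cast
    rfl

/-- The Wiener integral of a continuously differentiable function is a centred Gaussian variable,
with the variance given by the Itô isometry. -/
theorem ProbabilityTheory.IsBrownianReal.hasLaw_wienerIntegral {B : ℝ≥0 → Ω → ℝ}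
    (hB : IsBrownianReal B P) {h h' : ℝ → ℝ} (hh : ∀ s, HasDerivAt h (h' s) s)
    (hh' : Continuous h') (t : ℝ≥0) :
    HasLaw (fun ω => wienerIntegral h t fun s => B s ω)
      (gaussianReal 0 (∫ s in (0 : ℝ)..t, h s ^ 2).toNNReal) P := by
  have : IsProbabilityMeasure P := hB.isGaussianProcess.isProbabilityMeasure
  refine hasLaw_gaussianReal_of_tendsto_ae (fun m => hB.hasLaw_stieltjesSum h t m)
    ((continuous_real_toNNReal.tendsto _).comp (tendsto_sum_sq_mul hh hh' t)) ?_
  filter_upwards [hB.cont] with ω hω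
  rw [wienerIntegral_eq hh hh' hω]
  exact tendsto_stieltjesSum hh hh' hω t

/-- The pathwise Wiener integral is linear in the integrand, along continuous paths. -/
lemma wienerIntegral_linear {h h' k k' : ℝ → ℝ} (hh : ∀ s, HasDerivAt h (h' s) s)
    (hh' : Continuous h') (hk : ∀ s, HasDerivAt k (k' s) s) (hk' : Continuous k') (a b : ℝ)
    {p : ℝ≥0 → ℝ} (hp : Continuous p) (t : ℝ≥0) :
    wienerIntegral (fun s => a * h s + b * k s) t p
      = a * wienerIntegral h t p + b * wienerIntegral k t p := by
  have hq : Continuous fun s : ℝ => p s.toNNReal := hp.comp continuous_real_toNNReal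
  rw [wienerIntegral_eq (fun s => ((hh s).const_mul a).fun_add ((hk s).const_mul b))
    (by fun_prop) hp, wienerIntegral_eq hh hh' hp, wienerIntegral_eq hk hk' hp]
  have e : ∫ s in (0 : ℝ)..t, p s.toNNReal * (a * h' s + b * k' s)
      = a * (∫ s in (0 : ℝ)..t, p s.toNNReal * h' s)
        + b * ∫ s in (0 : ℝ)..t, p s.toNNReal * k' s := by
    rw [← intervalIntegral.integral_const_mul, ← intervalIntegral.integral_const_mul,
      ← intervalIntegral.integral_add (Continuous.intervalIntegrable (by fun_prop) _ _)
        (Continuous.intervalIntegrable (by fun_prop) _ _)]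
    refine intervalIntegral.integral_congr fun s _ => ?_
    ring
  rw [e]
  ring

namespace ProbabilityTheory.IsBrownianReal

variable {B : ℝ≥0 → Ω → ℝ} {h h' k k' : ℝ → ℝ}

lemma hasLaw_wienerIntegral_linear (hB : IsBrownianReal B P)
    (hh : ∀ s, HasDerivAt h (h' s) s) (hh' : Continuous h')
    (hk : ∀ s, HasDerivAt k (k' s) s) (hk' : Continuous k') (a b : ℝ) (t : ℝ≥0) :
    HasLaw (fun ω => a * wienerIntegral h t (fun s => B s ω)
        + b * wienerIntegral k t (fun s => B s ω))
      (gaussianReal 0 (∫ s in (0 : ℝ)..t, (a * h s + b * k s) ^ 2).toNNReal) P := by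
  refine (hB.hasLaw_wienerIntegral
    (fun s => ((hh s).const_mul a).fun_add ((hk s).const_mul b)) (by fun_prop) t).congr ?_
  filter_upwards [hB.cont] with ω hω
  rw [wienerIntegral_linear hh hh' hk hk' a b hω]

lemma aemeasurable_wienerIntegral (hB : IsBrownianReal B P)
    (hh : ∀ s, HasDerivAt h (h' s) s) (hh' : Continuous h') (t : ℝ≥0) :
    AEMeasurable (fun ω => wienerIntegral h t fun s => B s ω) P :=
  (hB.hasLaw_wienerIntegral hh hh' t).aemeasurable

/-- Two Wiener integrals against the same Brownian motion are jointly Gaussian, since all their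
linear combinations are Wiener integrals. -/
lemma hasGaussianLaw_wienerIntegral_prodMk (hB : IsBrownianReal B P)
    (hh : ∀ s, HasDerivAt h (h' s) s) (hh' : Continuous h')
    (hk : ∀ s, HasDerivAt k (k' s) s) (hk' : Continuous k') (t : ℝ≥0) :
    HasGaussianLaw (fun ω => (wienerIntegral h t (fun s => B s ω),
      wienerIntegral k t (fun s => B s ω))) P := by
  refine ⟨isGaussian_of_map_eq_gaussianReal fun L =>
    ⟨0, (∫ s in (0 : ℝ)..t, (L (1, 0) * h s + L (0, 1) * k s) ^ 2).toNNReal, ?_⟩⟩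
  rw [← (hB.hasLaw_wienerIntegral_linear hh hh' hk hk' (L (1, 0)) (L (0, 1)) t).map_eq,
    AEMeasurable.map_map_of_aemeasurable (by fun_prop)
      ((hB.aemeasurable_wienerIntegral hh hh' t).prodMk
        (hB.aemeasurable_wienerIntegral hk hk' t))]
  congr 1
  ext ω
  have e (x y : ℝ) : L (x, y) = L (1, 0) * x + L (0, 1) * y := by
    have : ((x, y) : ℝ × ℝ) = x • (1, 0) + y • (0, 1) := by simp
    rw [this, map_add, map_smul, map_smul, smul_eq_mul, smul_eq_mul]
    ring
  exact e _ _

lemma integral_wienerIntegral (hB : IsBrownianReal B P)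
    (hh : ∀ s, HasDerivAt h (h' s) s) (hh' : Continuous h') (t : ℝ≥0) :
    ∫ ω, wienerIntegral h t (fun s => B s ω) ∂P = 0 := by
  rw [(hB.hasLaw_wienerIntegral hh hh' t).integral_eq, integral_id_gaussianReal]

lemma variance_wienerIntegral (hB : IsBrownianReal B P)
    (hh : ∀ s, HasDerivAt h (h' s) s) (hh' : Continuous h') (t : ℝ≥0) :
    Var[fun ω => wienerIntegral h t (fun s => B s ω); P] = ∫ s in (0 : ℝ)..t, h s ^ 2 := by
  rw [(hB.hasLaw_wienerIntegral hh hh' t).variance_eq, variance_id_gaussianReal,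
    Real.coe_toNNReal _ (intervalIntegral.integral_nonneg t.coe_nonneg fun s _ => sq_nonneg _)]

/-- The covariance of two Wiener integrals is obtained from their variances by polarization. -/
lemma covariance_wienerIntegral (hB : IsBrownianReal B P)
    (hh : ∀ s, HasDerivAt h (h' s) s) (hh' : Continuous h')
    (hk : ∀ s, HasDerivAt k (k' s) s) (hk' : Continuous k') (t : ℝ≥0) :
    cov[fun ω => wienerIntegral h t (fun s => B s ω),
      fun ω => wienerIntegral k t (fun s => B s ω); P] = ∫ s in (0 : ℝ)..t, h s * k s := by
  have : IsProbabilityMeasure P := hB.isGaussianProcess.isProbabilityMeasure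
  have hch : Continuous h := continuous_iff_continuousAt.2 fun s => (hh s).continuousAt
  have hck : Continuous k := continuous_iff_continuousAt.2 fun s => (hk s).continuousAt
  have hadd := variance_fun_add (hB.hasLaw_wienerIntegral hh hh' t).hasGaussianLaw.memLp_two
    (hB.hasLaw_wienerIntegral hk hk' t).hasGaussianLaw.memLp_two
  have hlin := (hB.hasLaw_wienerIntegral_linear hh hh' hk hk' 1 1 t).variance_eq
  rw [variance_id_gaussianReal,
    Real.coe_toNNReal _ (intervalIntegral.integral_nonneg t.coe_nonneg fun s _ => sq_nonneg _)]
    at hlin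
  simp only [one_mul] at hlin
  rw [hlin, hB.variance_wienerIntegral hh hh', hB.variance_wienerIntegral hk hk'] at hadd
  have hexp : ∫ s in (0 : ℝ)..t, (h s + k s) ^ 2
      = (∫ s in (0 : ℝ)..t, h s ^ 2) + 2 * (∫ s in (0 : ℝ)..t, h s * k s)
        + ∫ s in (0 : ℝ)..t, k s ^ 2 := by
    rw [← intervalIntegral.integral_const_mul,
      ← intervalIntegral.integral_add (Continuous.intervalIntegrable (by fun_prop) _ _)
        (Continuous.intervalIntegrable (by fun_prop) _ _),
      ← intervalIntegral.integral_add (Continuous.intervalIntegrable (by fun_prop) _ _)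
        (Continuous.intervalIntegrable (by fun_prop) _ _)]
    refine intervalIntegral.integral_congr fun s _ => ?_
    ring
  linarith

end ProbabilityTheory.IsBrownianReal

end

/-! ### Pairs of vector-valued Wiener integrals -/

section

variable {Ω : Type*} [MeasurableSpace Ω] {P : Measure Ω}

/-- The pair of Wiener integrals `(∫₀ᵗ h dp, ∫₀ᵗ k dp)` along a path `p` in `ℝⁿ`, computed
coordinate by coordinate. -/
noncomputable def wienerPair {n : ℕ} (h k : ℝ → ℝ) (t : ℝ≥0)
    (p : ℝ≥0 → EuclideanSpace ℝ (Fin n)) :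
    EuclideanSpace ℝ (Fin n) × EuclideanSpace ℝ (Fin n) :=
  (WithLp.toLp 2 fun i => wienerIntegral h t fun s => p s i,
    WithLp.toLp 2 fun i => wienerIntegral k t fun s => p s i)

lemma measurable_wienerPair {n : ℕ} (h k : ℝ → ℝ) (t : ℝ≥0) :
    Measurable (wienerPair (n := n) h k t) := by
  have hpath (i : Fin n) :
      Measurable fun (p : ℝ≥0 → EuclideanSpace ℝ (Fin n)) (s : ℝ≥0) => p s i :=
    measurable_pi_lambda _ fun s => by fun_prop
  unfold wienerPair
  exact ((WithLp.measurable_toLp 2 _).comp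
      (measurable_pi_lambda _ fun i => (measurable_wienerIntegral h t).comp (hpath i))).prodMk
    ((WithLp.measurable_toLp 2 _).comp
      (measurable_pi_lambda _ fun i => (measurable_wienerIntegral k t).comp (hpath i)))

namespace IsBrownianVec

variable {n : ℕ} {B : ℝ≥0 → Ω → EuclideanSpace ℝ (Fin n)} {h h' k k' : ℝ → ℝ}

lemma hasGaussianLaw_wienerPair (hB : IsBrownianVec B P)
    (hh : ∀ s, HasDerivAt h (h' s) s) (hh' : Continuous h')
    (hk : ∀ s, HasDerivAt k (k' s) s) (hk' : Continuous k') (t : ℝ≥0) :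
    HasGaussianLaw (fun ω => wienerPair h k t fun s => B s ω) P := by
  have hind : iIndepFun (fun (i : Fin n) ω => (wienerIntegral h t (fun s => B s ω i),
      wienerIntegral k t (fun s => B s ω i))) P :=
    hB.iIndepFun_coord.comp (fun _ p => (wienerIntegral h t p, wienerIntegral k t p))
      fun _ => (measurable_wienerIntegral h t).prodMk (measurable_wienerIntegral k t)
  have hG := hind.hasGaussianLaw fun i =>
    (hB.isBrownianReal i).hasGaussianLaw_wienerIntegral_prodMk hh hh' hk hk' t
  let E : (Fin n → ℝ) →L[ℝ] EuclideanSpace ℝ (Fin n) := (EuclideanSpace.equiv (Fin n) ℝ).symm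
  exact hG.map_fun
    ((E ∘L .pi fun i => .fst ℝ ℝ ℝ ∘L .proj i).prod (E ∘L .pi fun i => .snd ℝ ℝ ℝ ∘L .proj i))

lemma integral_fst_wienerPair (hB : IsBrownianVec B P)
    (hh : ∀ s, HasDerivAt h (h' s) s) (hh' : Continuous h')
    (hk : ∀ s, HasDerivAt k (k' s) s) (hk' : Continuous k') (t : ℝ≥0) :
    ∫ ω, (wienerPair h k t fun s => B s ω).1 ∂P = 0 := by
  ext i
  have hint := (hB.hasGaussianLaw_wienerPair hh hh' hk hk' t).fst.integrable
  exact ((EuclideanSpace.proj (𝕜 := ℝ) i).integral_comp_comm hint).symm.trans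
    ((hB.isBrownianReal i).integral_wienerIntegral hh hh' t)

lemma integral_snd_wienerPair (hB : IsBrownianVec B P)
    (hh : ∀ s, HasDerivAt h (h' s) s) (hh' : Continuous h')
    (hk : ∀ s, HasDerivAt k (k' s) s) (hk' : Continuous k') (t : ℝ≥0) :
    ∫ ω, (wienerPair h k t fun s => B s ω).2 ∂P = 0 :=
  hB.integral_fst_wienerPair hk hk' hh hh' t

lemma covariance_wienerIntegral (hB : IsBrownianVec B P)
    (hh : ∀ s, HasDerivAt h (h' s) s) (hh' : Continuous h')
    (hk : ∀ s, HasDerivAt k (k' s) s) (hk' : Continuous k') (t : ℝ≥0) (i j : Fin n) :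
    cov[fun ω => wienerIntegral h t (fun s => B s ω i),
      fun ω => wienerIntegral k t (fun s => B s ω j); P]
      = ((∫ s in (0 : ℝ)..t, h s * k s) • (1 : Matrix (Fin n) (Fin n) ℝ)) i j := by
  by_cases hij : i = j
  · subst hij
    simpa using (hB.isBrownianReal i).covariance_wienerIntegral hh hh' hk hk' t
  · have hind := (hB.iIndepFun_coord.indepFun hij).comp (measurable_wienerIntegral h t)
      (measurable_wienerIntegral k t)
    have hzero : ((∫ s in (0 : ℝ)..t, h s * k s) • (1 : Matrix (Fin n) (Fin n) ℝ)) i j = 0 := by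
      simp [hij]
    rw [hzero]
    exact hind.covariance_eq_zero
      ((hB.isBrownianReal i).hasLaw_wienerIntegral hh hh' t).hasGaussianLaw.memLp_two
      ((hB.isBrownianReal j).hasLaw_wienerIntegral hk hk' t).hasGaussianLaw.memLp_two

end IsBrownianVec

/-! ### Conditioning on an independent variable -/

/-- If `Z = φ(X) + W` with `W` independent of `X`, the conditional law of `Z` given `X = x` is the
law of `W` translated by `φ(x)`. -/
lemma condDistrib_ae_eq_map_add {S F : Type*} [MeasurableSpace S] [MeasurableSpace F]
    [StandardBorelSpace F] [Nonempty F] [Add F] [MeasurableAdd₂ F] [IsProbabilityMeasure P]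
    {X : Ω → S} {W Z : Ω → F} {φ : S → F} (hφ : Measurable φ) (hX : AEMeasurable X P)
    (hW : AEMeasurable W P) (hXW : IndepFun X W P) (hZ : Z =ᵐ[P] fun ω => φ (X ω) + W ω) :
    ∀ᵐ x ∂(P.map X), condDistrib Z X P x = (P.map W).map (φ x + ·) := by
  have := Measure.isProbabilityMeasure_map hX
  have := Measure.isProbabilityMeasure_map hW
  have hg : Measurable fun q : S × F => φ q.1 + q.2 := by fun_prop
  have hZm : AEMeasurable Z P := (hg.comp_aemeasurable (hX.prodMk hW)).congr hZ.symm
  let κ : Kernel S F := (Kernel.id ×ₖ Kernel.const S (P.map W)).map fun q => φ q.1 + q.2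
  have hκ (x : S) : κ x = (P.map W).map (φ x + ·) := by
    rw [Kernel.map_apply _ hg, Kernel.prod_apply, Kernel.id_apply, Kernel.const_apply,
      Measure.dirac_prod, Measure.map_map hg (by fun_prop)]
    rfl
  have : IsMarkovKernel κ := Kernel.IsMarkovKernel.map _ hg
  have hjoint : P.map (fun ω => (X ω, Z ω)) = P.map X ⊗ₘ κ := by
    refine Measure.ext_of_lintegral _ fun f hf => ?_
    have hprod := (indepFun_iff_map_prod_eq_prod_map_map hX hW).1 hXW
    have hfg : Measurable fun q : S × F => f (q.1, φ q.1 + q.2) := by fun_prop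
    calc ∫⁻ q, f q ∂P.map (fun ω => (X ω, Z ω))
        = ∫⁻ ω, f (X ω, φ (X ω) + W ω) ∂P := by
          rw [lintegral_map' hf.aemeasurable (hX.prodMk hZm)]
          refine lintegral_congr_ae ?_
          filter_upwards [hZ] with ω hω
          rw [hω]
      _ = ∫⁻ q, f (q.1, φ q.1 + q.2) ∂((P.map X).prod (P.map W)) := by
          rw [← hprod, lintegral_map' hfg.aemeasurable (hX.prodMk hW)]
      _ = ∫⁻ q, f q ∂(P.map X ⊗ₘ κ) := by
          rw [lintegral_prod _ hfg.aemeasurable, Measure.lintegral_compProd hf]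
          refine lintegral_congr fun x => ?_
          rw [hκ, lintegral_map (f := fun y => f (x, y)) (g := (φ x + ·)) (by fun_prop)
            (by fun_prop)]
  filter_upwards [condDistrib_ae_eq_of_measure_eq_compProd X hZm hjoint] with x hx
  rw [hx, hκ]

end

/-! ### The explicit solution of the Langevin equation -/

/-- Variation of constants for the position: `I(s) = ∫₀ˢ v` solves the linear equation
`I' = v₀ - γ I - u s g + c q`, which is integrated against the factor `exp(γ s)`. -/
lemma integral_velocity_eq {γ u c v₀ g : ℝ} (hγ : γ ≠ 0) {v q : ℝ → ℝ} (hv : Continuous v)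
    (hq : Continuous q)
    (hsol : ∀ s, 0 ≤ s → v s = v₀ + (∫ r in (0 : ℝ)..s, (-(γ * v r) - u * g)) + c * q s)
    {t : ℝ} (ht : 0 ≤ t) :
    ∫ s in (0 : ℝ)..t, v s = γ⁻¹ * (1 - Real.exp (-γ * t)) * v₀
      - γ⁻¹ * u * (t - γ⁻¹ * (1 - Real.exp (-γ * t))) * g
      + c * ∫ s in (0 : ℝ)..t, Real.exp (-γ * (t - s)) * q s := by
  set I : ℝ → ℝ := fun s => ∫ r in (0 : ℝ)..s, v r with hI
  -- the solution without noise
  set A : ℝ → ℝ := fun s => γ⁻¹ * (1 - Real.exp (-γ * s)) * v₀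
    - γ⁻¹ * u * (s - γ⁻¹ * (1 - Real.exp (-γ * s))) * g with hA
  have hdI (s : ℝ) : HasDerivAt I (v s) s := hv.integral_hasStrictDerivAt 0 s |>.hasDerivAt
  have hvI (s : ℝ) (hs : 0 ≤ s) : v s = v₀ - γ * I s - u * s * g + c * q s := by
    rw [hsol s hs, intervalIntegral.integral_sub
      (Continuous.intervalIntegrable (by fun_prop) _ _) intervalIntegrable_const,
      intervalIntegral.integral_neg, intervalIntegral.integral_const_mul]
    simp only [intervalIntegral.integral_const, smul_eq_mul, hI]
    ring
  have hexp (a s : ℝ) : HasDerivAt (fun s => Real.exp (a * s)) (a * Real.exp (a * s)) s := by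
    simpa [mul_comm] using ((hasDerivAt_id s).const_mul a).exp
  have hdA (s : ℝ) : HasDerivAt A (Real.exp (-γ * s) * v₀
      - γ⁻¹ * u * (1 - Real.exp (-γ * s)) * g) s := by
    have h1 : HasDerivAt (fun s => γ⁻¹ * (1 - Real.exp (-γ * s))) (Real.exp (-γ * s)) s := by
      refine HasDerivAt.congr_deriv
        (((hexp (-γ) s).const_sub 1).const_mul γ⁻¹) ?_
      field_simp
    exact (h1.mul_const v₀).fun_sub
      ((((hasDerivAt_id s).fun_sub h1).const_mul (γ⁻¹ * u)).mul_const g)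
  have hD (s : ℝ) (hs : s ∈ Set.uIcc 0 t) :
      HasDerivAt (fun s => Real.exp (γ * s) * (I s - A s)) (c * (Real.exp (γ * s) * q s)) s := by
    rw [Set.uIcc_of_le ht] at hs
    refine HasDerivAt.congr_deriv
      ((hexp γ s).fun_mul ((hdI s).fun_sub (hdA s))) ?_
    rw [hvI s hs.1]
    simp only [hA]
    field_simp
    ring
  have hFTC := intervalIntegral.integral_eq_sub_of_hasDerivAt hD
    (Continuous.intervalIntegrable (by fun_prop) _ _)
  have hI0 : I 0 = 0 := by simp [hI]
  have hA0 : A 0 = 0 := by simp [hA]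
  rw [intervalIntegral.integral_const_mul, hI0, hA0, sub_zero, mul_zero, sub_zero] at hFTC
  have hpull : ∫ s in (0 : ℝ)..t, Real.exp (-γ * (t - s)) * q s
      = Real.exp (-γ * t) * ∫ s in (0 : ℝ)..t, Real.exp (γ * s) * q s := by
    rw [← intervalIntegral.integral_const_mul]
    refine intervalIntegral.integral_congr fun s _ => ?_
    rw [← mul_assoc, ← Real.exp_add]
    ring_nf
  have hcancel : Real.exp (-γ * t) * Real.exp (γ * t) = 1 := by
    rw [← Real.exp_add]
    simp
  rw [hpull, mul_left_comm, hFTC, ← mul_assoc, hcancel]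
  ring

/-- The response at time `t` of the velocity to noise of intensity `c` at time `s`. -/
noncomputable def velocityResponse (γ c t s : ℝ) : ℝ := c * Real.exp (-γ * (t - s))

/-- The response at time `t` of the position to noise of intensity `c` at time `s`. -/
noncomputable def positionResponse (γ c t s : ℝ) : ℝ := c * (γ⁻¹ * (1 - Real.exp (-γ * (t - s))))

lemma hasDerivAt_exp_neg_mul_sub (γ t s : ℝ) :
    HasDerivAt (fun s => Real.exp (-γ * (t - s))) (γ * Real.exp (-γ * (t - s))) s := by
  simpa [mul_comm] using (((hasDerivAt_id s).const_sub t).const_mul (-γ)).exp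

lemma hasDerivAt_velocityResponse (γ c t s : ℝ) :
    HasDerivAt (velocityResponse γ c t) (c * (γ * Real.exp (-γ * (t - s)))) s :=
  (hasDerivAt_exp_neg_mul_sub γ t s).const_mul c

lemma hasDerivAt_positionResponse {γ : ℝ} (hγ : γ ≠ 0) (c t s : ℝ) :
    HasDerivAt (positionResponse γ c t) (c * -Real.exp (-γ * (t - s))) s := by
  refine HasDerivAt.congr_deriv
    ((((hasDerivAt_exp_neg_mul_sub γ t s).const_sub 1).const_mul γ⁻¹).const_mul c) ?_
  field_simp

/-- In one dimension, along a fixed path `p` of the noise, the solution is the sum of the solution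
without noise and of Wiener integrals. -/
lemma langevin_eq_add_wienerIntegral {γ u c v₀ g : ℝ} (hγ : γ ≠ 0) {v : ℝ → ℝ} {p : ℝ≥0 → ℝ}
    (hv : Continuous v) (hp : Continuous p) (hp0 : p 0 = 0)
    (hsol : ∀ s : ℝ≥0, v s = v₀ + (∫ r in (0 : ℝ)..s, (-(γ * v r) - u * g)) + c * p s)
    (t : ℝ≥0) :
    ∫ s in (0 : ℝ)..t, v s = γ⁻¹ * (1 - Real.exp (-γ * t)) * v₀
        - γ⁻¹ * u * (t - γ⁻¹ * (1 - Real.exp (-γ * t))) * g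
        + wienerIntegral (positionResponse γ c t) t p ∧
      v t = Real.exp (-γ * t) * v₀ - γ⁻¹ * u * (1 - Real.exp (-γ * t)) * g
        + wienerIntegral (velocityResponse γ c t) t p := by
  have hq : Continuous fun s : ℝ => p s.toNNReal := hp.comp continuous_real_toNNReal
  have hint := integral_velocity_eq hγ hv hq (fun s hs => by
    simpa [Real.coe_toNNReal s hs] using hsol s.toNNReal) t.coe_nonneg
  have hvt : v t = v₀ - γ * (∫ s in (0 : ℝ)..t, v s) - u * t * g + c * p t := by
    rw [hsol t, intervalIntegral.integral_sub
      (Continuous.intervalIntegrable (by fun_prop) _ _) intervalIntegrable_const,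
      intervalIntegral.integral_neg, intervalIntegral.integral_const_mul]
    simp only [intervalIntegral.integral_const, smul_eq_mul]
    ring
  set N := ∫ s in (0 : ℝ)..t, Real.exp (-γ * (t - s)) * p s.toNNReal
  have hpos : wienerIntegral (positionResponse γ c t) t p = c * N := by
    rw [wienerIntegral_eq (fun s => hasDerivAt_positionResponse hγ c t s) (by fun_prop) hp, hp0,
      ← intervalIntegral.integral_const_mul]
    simp only [positionResponse, sub_self, mul_zero, Real.exp_zero, zero_mul, zero_sub,
      ← intervalIntegral.integral_neg]
    refine intervalIntegral.integral_congr fun s _ => ?_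
    ring
  have hvel : wienerIntegral (velocityResponse γ c t) t p = c * p t - γ * (c * N) := by
    rw [wienerIntegral_eq (fun s => hasDerivAt_velocityResponse γ c t s) (by fun_prop) hp, hp0,
      ← mul_assoc, ← intervalIntegral.integral_const_mul]
    simp only [velocityResponse, sub_self, mul_zero, Real.exp_zero, mul_one, sub_zero]
    congr 1
    refine intervalIntegral.integral_congr fun s _ => ?_
    ring
  refine ⟨by rw [hint, hpos], ?_⟩
  rw [hvt, hint, hvel]
  field_simp
  ring

/-! ### The covariance integrals -/

section Covariance

variable {γ u c : ℝ}

lemma exp_neg_two_mul (γ t : ℝ) : Real.exp (-2 * γ * t) = Real.exp (-γ * t) ^ 2 := by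
  rw [← Real.exp_nat_mul]
  ring_nf

lemma integral_positionResponse_sq (hγ : γ ≠ 0) (hc : c ^ 2 = 2 * γ * u) (t : ℝ) :
    ∫ s in (0 : ℝ)..t, positionResponse γ c t s * positionResponse γ c t s
      = γ⁻¹ * u * (2 * t - 4 * γ⁻¹ * (1 - Real.exp (-γ * t))
          + γ⁻¹ * (1 - Real.exp (-2 * γ * t))) := by
  have hF (s : ℝ) : HasDerivAt (fun s => γ⁻¹ * u * (2 * s - 4 * γ⁻¹ * Real.exp (-γ * (t - s))
      + γ⁻¹ * Real.exp (-γ * (t - s)) ^ 2))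
      (positionResponse γ c t s * positionResponse γ c t s) s := by
    have hE := hasDerivAt_exp_neg_mul_sub γ t s
    refine HasDerivAt.congr_deriv
      (((((hasDerivAt_id s).const_mul 2).fun_sub (hE.const_mul (4 * γ⁻¹))).fun_add
      ((hE.fun_pow 2).const_mul γ⁻¹)).const_mul (γ⁻¹ * u)) ?_
    simp only [positionResponse]
    rw [show ∀ x : ℝ, c * x * (c * x) = c ^ 2 * x ^ 2 from fun x => by ring, hc]
    field_simp
    push_cast
    ring
  rw [intervalIntegral.integral_eq_sub_of_hasDerivAt (fun s _ => hF s)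
    (Continuous.intervalIntegrable (by unfold positionResponse; fun_prop) _ _), exp_neg_two_mul]
  simp only [sub_self, mul_zero, Real.exp_zero, sub_zero]
  ring

lemma integral_velocityResponse_sq (hc : c ^ 2 = 2 * γ * u) (t : ℝ) :
    ∫ s in (0 : ℝ)..t, velocityResponse γ c t s * velocityResponse γ c t s
      = u * (1 - Real.exp (-2 * γ * t)) := by
  have hF (s : ℝ) : HasDerivAt (fun s => u * Real.exp (-γ * (t - s)) ^ 2)
      (velocityResponse γ c t s * velocityResponse γ c t s) s := by
    have hE := hasDerivAt_exp_neg_mul_sub γ t s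
    refine HasDerivAt.congr_deriv
      ((hE.fun_pow 2).const_mul u) ?_
    simp only [velocityResponse]
    rw [show ∀ x : ℝ, c * x * (c * x) = c ^ 2 * x ^ 2 from fun x => by ring, hc]
    push_cast
    ring
  rw [intervalIntegral.integral_eq_sub_of_hasDerivAt (fun s _ => hF s)
    (Continuous.intervalIntegrable (by unfold velocityResponse; fun_prop) _ _), exp_neg_two_mul]
  simp only [sub_self, mul_zero, Real.exp_zero, sub_zero]
  ring

lemma integral_positionResponse_mul_velocityResponse (hc : c ^ 2 = 2 * γ * u) (t : ℝ) :
    ∫ s in (0 : ℝ)..t, positionResponse γ c t s * velocityResponse γ c t s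
      = γ⁻¹ * u * (1 - 2 * Real.exp (-γ * t) + Real.exp (-2 * γ * t)) := by
  have hF (s : ℝ) : HasDerivAt (fun s => γ⁻¹ * u * (2 * Real.exp (-γ * (t - s))
      - Real.exp (-γ * (t - s)) ^ 2))
      (positionResponse γ c t s * velocityResponse γ c t s) s := by
    have hE := hasDerivAt_exp_neg_mul_sub γ t s
    refine HasDerivAt.congr_deriv
      (((hE.const_mul 2).fun_sub (hE.fun_pow 2)).const_mul (γ⁻¹ * u)) ?_
    simp only [positionResponse, velocityResponse]
    rw [show ∀ x y : ℝ, c * x * (c * y) = c ^ 2 * (x * y) from fun x y => by ring, hc]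
    push_cast
    ring
  rw [intervalIntegral.integral_eq_sub_of_hasDerivAt (fun s _ => hF s)
    (Continuous.intervalIntegrable (by unfold positionResponse velocityResponse; fun_prop) _ _),
    exp_neg_two_mul]
  simp only [sub_self, mul_zero, Real.exp_zero, sub_zero]
  ring

end Covariance

/-! ### The conditional law -/

/-- The state at time `t` of the frozen Langevin equation without noise, started at `x`. -/
noncomputable def noiselessFlow {n : ℕ} (γ u : ℝ) (f : EuclideanSpace ℝ (Fin n) → ℝ) (t : ℝ≥0)
    (x : EuclideanSpace ℝ (Fin n) × EuclideanSpace ℝ (Fin n)) :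
    EuclideanSpace ℝ (Fin n) × EuclideanSpace ℝ (Fin n) :=
  (x.1 + (γ⁻¹ * (1 - Real.exp (-γ * t))) • x.2
      - (γ⁻¹ * u * (t - γ⁻¹ * (1 - Real.exp (-γ * t)))) • gradient f x.1,
    Real.exp (-γ * t) • x.2 - (γ⁻¹ * u * (1 - Real.exp (-γ * t))) • gradient f x.1)

lemma measurable_noiselessFlow {n : ℕ} (γ u : ℝ) (f : EuclideanSpace ℝ (Fin n) → ℝ) (t : ℝ≥0) :
    Measurable (noiselessFlow γ u f t) := by
  have hgrad : Measurable (gradient f) := by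
    unfold gradient
    exact (InnerProductSpace.toDual ℝ _).symm.continuous.measurable.comp (measurable_fderiv ℝ f)
  unfold noiselessFlow
  fun_prop

section

variable {Ω : Type*} [MeasurableSpace Ω] {P : Measure Ω} {n : ℕ} {γ u : ℝ}
  {f : EuclideanSpace ℝ (Fin n) → ℝ} {B Y V : ℝ≥0 → Ω → EuclideanSpace ℝ (Fin n)}

/-- Almost surely the solution is the noiseless flow plus a pair of Wiener integrals. -/
lemma IsFrozenLangevin.ae_eq_noiselessFlow_add (hsol : IsFrozenLangevin γ u f B Y V P)
    (hB : IsBrownianVec B P) (hγ : γ ≠ 0) (t : ℝ≥0) :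
    (fun ω => (Y t ω, V t ω)) =ᵐ[P] fun ω => noiselessFlow γ u f t (Y 0 ω, V 0 ω)
      + wienerPair (positionResponse γ √(2 * γ * u) t) (velocityResponse γ √(2 * γ * u) t) t
        fun s => B s ω := by
  filter_upwards [hsol.continuous_velocity, hsol.velocity_eq, hsol.position_eq,
    ae_all_iff.2 fun i => (hB.isBrownianReal i).cont,
    ae_all_iff.2 fun i => (hB.isBrownianReal i).eval_zero_ae_eq_zero] with ω hV hVeq hYeq hBc hB0
  have hVr : Continuous fun s : ℝ => V s.toNNReal ω := hV.comp continuous_real_toNNReal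
  have hcoord (i : Fin n) {F : ℝ → EuclideanSpace ℝ (Fin n)} (hF : Continuous F) (s : ℝ) :
      (∫ r in (0 : ℝ)..s, F r) i = ∫ r in (0 : ℝ)..s, F r i :=
    ((EuclideanSpace.proj (𝕜 := ℝ) i).intervalIntegral_comp_comm
      (hF.intervalIntegrable _ _)).symm
  have key (i : Fin n) := langevin_eq_add_wienerIntegral (u := u) (c := √(2 * γ * u))
    (v₀ := V 0 ω i) (g := gradient f (Y 0 ω) i) hγ (v := fun s => V s.toNNReal ω i)
    (p := fun s => B s ω i) (by fun_prop) (hBc i) (hB0 i) (fun s => by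
      have h := congrArg (fun z : EuclideanSpace ℝ (Fin n) => z i) (hVeq s)
      simp only [PiLp.add_apply, PiLp.smul_apply, PiLp.sub_apply, smul_eq_mul] at h
      rw [hcoord i (by fun_prop), hB0 i, sub_zero] at h
      simpa using h) t
  refine Prod.ext ?_ ?_
  · ext i
    have h := congrArg (fun z : EuclideanSpace ℝ (Fin n) => z i) (hYeq t)
    simp only [PiLp.add_apply] at h
    rw [hcoord i hVr, (key i).1] at h
    simp only [noiselessFlow, wienerPair, Prod.mk_add_mk, PiLp.add_apply, PiLp.sub_apply,
      PiLp.smul_apply, smul_eq_mul]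
    rw [h]
    ring
  · ext i
    have h := (key i).2
    simp only [Real.toNNReal_coe] at h
    simp only [noiselessFlow, wienerPair, Prod.mk_add_mk, PiLp.add_apply, PiLp.sub_apply,
      PiLp.smul_apply, smul_eq_mul]
    exact h

end

/-- Translating a random vector does not change its covariance matrices. -/
lemma crossCov_map_const_add {Ω S : Type*} [MeasurableSpace Ω] [MeasurableSpace S] {P : Measure Ω}
    [IsProbabilityMeasure P] {n : ℕ} [Add S] [MeasurableAdd S]
    {W : Ω → S} (hW : AEMeasurable W P) (a : S) {F G : S → EuclideanSpace ℝ (Fin n)}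
    (hF : Measurable F) (hG : Measurable G) (hFadd : ∀ x y, F (x + y) = F x + F y)
    (hGadd : ∀ x y, G (x + y) = G x + G y)
    (hFW : Integrable (fun ω => F (W ω)) P) (hGW : Integrable (fun ω => G (W ω)) P) (i j : Fin n) :
    crossCov F G ((P.map W).map (a + ·)) i j
      = cov[fun ω => F (W ω) i, fun ω => G (W ω) j; P] := by
  have hFi : Measurable fun x => F x i := by fun_prop
  have hGj : Measurable fun x => G x j := by fun_prop
  rw [AEMeasurable.map_map_of_aemeasurable (by fun_prop) hW, crossCov, Matrix.of_apply,
    covariance_map_fun hFi.aestronglyMeasurable hGj.aestronglyMeasurable (by fun_prop)]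
  simp only [Function.comp_apply, hFadd, hGadd, PiLp.add_apply]
  have hFWi : Integrable (fun ω => F (W ω) i) P :=
    (EuclideanSpace.proj (𝕜 := ℝ) i).integrable_comp hFW
  have hGWj : Integrable (fun ω => G (W ω) j) P :=
    (EuclideanSpace.proj (𝕜 := ℝ) j).integrable_comp hGW
  rw [covariance_const_add_left hFWi, covariance_const_add_right hGWj]

lemma integral_map_const_add {Ω S E : Type*} [MeasurableSpace Ω] [MeasurableSpace S]
    [NormedAddCommGroup E] [NormedSpace ℝ E] [CompleteSpace E] [MeasurableSpace E] [BorelSpace E]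
    [SecondCountableTopology E] {P : Measure Ω} [IsProbabilityMeasure P] [Add S] [MeasurableAdd S]
    {W : Ω → S} (hW : AEMeasurable W P) (a : S) {F : S → E} (hF : Measurable F)
    (hFadd : ∀ x y, F (x + y) = F x + F y) (hFW : Integrable (fun ω => F (W ω)) P) :
    ∫ z, F z ∂((P.map W).map (a + ·)) = F a + ∫ ω, F (W ω) ∂P := by
  rw [AEMeasurable.map_map_of_aemeasurable (by fun_prop) hW,
    integral_map (by fun_prop) hF.aestronglyMeasurable]
  simp only [Function.comp_apply, hFadd]
  rw [integral_add (integrable_const _) hFW, integral_const]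
  simp

theorem mainTheorem4 {Ω : Type*} [MeasurableSpace Ω] (P : Measure Ω) [IsProbabilityMeasure P]
    (n : ℕ) (γ u : ℝ) (hγ : 0 < γ) (hu : 0 < u)
    (f : EuclideanSpace ℝ (Fin n) → ℝ) (hf : Differentiable ℝ f)
    (B Y V : ℝ≥0 → Ω → EuclideanSpace ℝ (Fin n))
    (hB : IsBrownianVec B P)
    (hindep : IndepFun (fun ω => (Y 0 ω, V 0 ω)) (fun ω t => B t ω) P)
    (hsol : IsFrozenLangevin γ u f B Y V P) (t : ℝ≥0) :
    ∀ᵐ x ∂(P.map fun ω => (Y 0 ω, V 0 ω)), ∀ y₀ v₀ : EuclideanSpace ℝ (Fin n), x = (y₀, v₀) →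
      ∀ ν : Measure (EuclideanSpace ℝ (Fin n) × EuclideanSpace ℝ (Fin n)),
        ν = condDistrib (fun ω => (Y t ω, V t ω)) (fun ω => (Y 0 ω, V 0 ω)) P x →
        IsGaussian ν ∧
        ∫ z, z.2 ∂ν = Real.exp (-γ * t) • v₀
          - (γ⁻¹ * u * (1 - Real.exp (-γ * t))) • gradient f y₀ ∧
        ∫ z, z.1 ∂ν = y₀ + (γ⁻¹ * (1 - Real.exp (-γ * t))) • v₀
          - (γ⁻¹ * u * (t - γ⁻¹ * (1 - Real.exp (-γ * t)))) • gradient f y₀ ∧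
        crossCov Prod.fst Prod.fst ν
          = (γ⁻¹ * u * (2 * t - 4 * γ⁻¹ * (1 - Real.exp (-γ * t))
              + γ⁻¹ * (1 - Real.exp (-2 * γ * t)))) • (1 : Matrix (Fin n) (Fin n) ℝ) ∧
        crossCov Prod.snd Prod.snd ν
          = (u * (1 - Real.exp (-2 * γ * t))) • (1 : Matrix (Fin n) (Fin n) ℝ) ∧
        crossCov Prod.fst Prod.snd ν
          = (γ⁻¹ * u * (1 - 2 * Real.exp (-γ * t) + Real.exp (-2 * γ * t)))
              • (1 : Matrix (Fin n) (Fin n) ℝ) := by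
  have hγ0 : γ ≠ 0 := hγ.ne'
  set c := √(2 * γ * u) with hc_def
  have hc : c ^ 2 = 2 * γ * u := Real.sq_sqrt (by positivity)
  have hpos := fun s => hasDerivAt_positionResponse hγ0 c t s
  have hpos' : Continuous fun s => c * -Real.exp (-γ * (t - s)) := by fun_prop
  have hvel := fun s => hasDerivAt_velocityResponse γ c t s
  have hvel' : Continuous fun s => c * (γ * Real.exp (-γ * (t - s))) := by fun_prop
  set W : Ω → EuclideanSpace ℝ (Fin n) × EuclideanSpace ℝ (Fin n) := fun ω =>
    wienerPair (positionResponse γ c t) (velocityResponse γ c t) t fun s => B s ω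
  have hG : HasGaussianLaw W P := hB.hasGaussianLaw_wienerPair hpos hpos' hvel hvel' t
  have hWm : AEMeasurable W P := hG.aemeasurable
  have hW1 : Integrable (fun ω => (W ω).1) P := hG.fst.integrable
  have hW2 : Integrable (fun ω => (W ω).2) P := hG.snd.integrable
  have hX : AEMeasurable (fun ω => (Y 0 ω, V 0 ω)) P :=
    (hsol.aemeasurable_position 0).prodMk (hsol.aemeasurable_velocity 0)
  have hXW : IndepFun (fun ω => (Y 0 ω, V 0 ω)) W P :=
    hindep.comp measurable_id (measurable_wienerPair _ _ t)
  filter_upwards [condDistrib_ae_eq_map_add (measurable_noiselessFlow γ u f t) hX hWm hXW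
    (hsol.ae_eq_noiselessFlow_add hB hγ0 t)] with x hx y₀ v₀ hxy ν hν
  rw [hx] at hν
  subst hxy hν
  have := hG.isGaussian_map
  refine ⟨inferInstance, ?_, ?_, ?_, ?_, ?_⟩
  · rw [integral_map_const_add hWm _ measurable_snd (fun _ _ => rfl) hW2,
      hB.integral_snd_wienerPair hpos hpos' hvel hvel' t, add_zero]
    rfl
  · rw [integral_map_const_add hWm _ measurable_fst (fun _ _ => rfl) hW1,
      hB.integral_fst_wienerPair hpos hpos' hvel hvel' t, add_zero]
    rfl
  · ext i j
    rw [crossCov_map_const_add hWm _ measurable_fst measurable_fst (fun _ _ => rfl)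
      (fun _ _ => rfl) hW1 hW1, ← integral_positionResponse_sq hγ0 hc]
    exact hB.covariance_wienerIntegral hpos hpos' hpos hpos' t i j
  · ext i j
    rw [crossCov_map_const_add hWm _ measurable_snd measurable_snd (fun _ _ => rfl)
      (fun _ _ => rfl) hW2 hW2, ← integral_velocityResponse_sq hc]
    exact hB.covariance_wienerIntegral hvel hvel' hvel hvel' t i j
  · ext i j
    rw [crossCov_map_const_add hWm _ measurable_fst measurable_snd (fun _ _ => rfl)
      (fun _ _ => rfl) hW1 hW2, ← integral_positionResponse_mul_velocityResponse hc]
    exact hB.covariance_wienerIntegral hpos hpos' hvel hvel' t i j
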